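/- Identify $\mathrm{Mat}_2(\mathbb C)\otimes\mathrm{Mat}_2(\mathbb C)$ with $\mathrm{Mat}_4(\mathbb C)$ through the Kronecker product, and let $\Gamma$ be the partial transpose, i.e. the linear map with $(A\otimes B)^\Gamma=A^T\otimes B$. Let $$\mathrm{Decomp}_{2,2}=\{X+Y \mid X\succeq 0,\ Y^\Gamma\succeq 0\},\qquad \mathrm{Bpsd}_{2,2}=\{M\mid (x\otimes y)^*M(x\otimes y)\ge 0\ \text{ for all } x,y\in\mathbb C^2\}$$ be the sets of decomposable and of block positive matrices in $\mathrm{Mat}_2(\mathbb C)\otimes\mathrm{Mat}_2(\mathbb C)$. Then $\mathrm{Decomp}_{2,2}=\mathrm{Bpsd}_{2,2}$, and this set is a convex cone contained in the $16$-dimensional real vector space $\mathrm{Her}_2(\mathbb C)\otimes\mathrm{Her}_2(\mathbb C)=\mathrm{Her}_4(\mathbb C)$ of Hermitian matrices. As a subset of $\mathrm{Her}_4(\mathbb C)\cong\mathbb R^{16}$ it has the following properties. 1. It has a non-exposed face. Here a face of a convex set $C$ is a nonempty convex subset $F\subseteq C$ such that $x,y\in C$, $\lambda\in(0,1)$ and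 $\lambda x+(1-\lambda)y\in F$ imply $x,y\in F$; it is exposed if $F=C$ or $F=\{a\in C\mid \ell(a)=0\}$ for some affine linear function $\ell$ on the ambient space with $\ell\ge 0$ on $C$. 2. It is not basic closed semialgebraic, i.e. not of the form $\{a\mid p_1(a)\ge 0,\dots,p_r(a)\ge 0\}$ with finitely many real polynomials $p_1,\dots,p_r$ in linear coordinates. 3. In particular, it is not a (classical) spectrahedron, i.e. not of the form $\{a\mid a_1B_1+\dots+a_{16}B_{16}\succeq 0\}$ with Hermitian matrices $B_1,\dots,B_{16}$ of some common size $r$, where $a_1,\dots,a_{16}$ are linear coordinates of $a$. -/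

import Mathlib

open scoped ComplexOrder Kronecker

/-- `Mat_d(ℂ) ⊗ Mat_s(ℂ)`, realized through the Kronecker product as the complex matrices
indexed by `Fin d × Fin s`. Each such matrix is a finite sum of matrices `A ⊗ₖ B`. -/
abbrev TensorMat (d s : ℕ) : Type := Matrix (Fin d × Fin s) (Fin d × Fin s) ℂ

/-- `Her_d(ℂ) ⊗ Her_s(ℂ) = Her_{ds}(ℂ)`: the real vector space of Hermitian matrices in
`Mat_d(ℂ) ⊗ Mat_s(ℂ)`. -/
abbrev HerTensor (d s : ℕ) : Type := selfAdjoint (TensorMat d s)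

/-- The partial transpose `Γ`, determined by `(A ⊗ B)^Γ = Aᵀ ⊗ B`. -/
def partialTranspose (d s : ℕ) : TensorMat d s →ₗ[ℂ] TensorMat d s where
  toFun M := Matrix.of fun p q => M (q.1, p.2) (p.1, q.2)
  map_add' _ _ := rfl
  map_smul' _ _ := rfl

theorem partialTranspose_kronecker (d s : ℕ) (A : Matrix (Fin d) (Fin d) ℂ)
    (B : Matrix (Fin s) (Fin s) ℂ) :
    partialTranspose d s (A ⊗ₖ B) = Matrix.transpose A ⊗ₖ B := rfl

/-- The positive semidefinite matrices (Hermitian by definition). -/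
def Psd (d s : ℕ) : Set (TensorMat d s) := {X | X.PosSemidef}

/-- The matrices with positive semidefinite partial transpose. -/
def PsdGamma (d s : ℕ) : Set (TensorMat d s) := {X | (partialTranspose d s X).PosSemidef}

/-- The decomposable matrices. -/
def Decomp (d s : ℕ) : Set (TensorMat d s) :=
  {M | ∃ X ∈ Psd d s, ∃ Y ∈ PsdGamma d s, M = X + Y}

/-- The elementary tensor `x ⊗ y` in `ℂ^d ⊗ ℂ^s`. -/
def vecTensor {d s : ℕ} (x : Fin d → ℂ) (y : Fin s → ℂ) : Fin d × Fin s → ℂ :=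
  fun p => x p.1 * y p.2

/-- The block positive matrices: `(x ⊗ y)^* M (x ⊗ y) ≥ 0` for all `x`, `y`. The inequality
`0 ≤ z` for complex `z` means that `z` is real and nonnegative. -/
def Bpsd (d s : ℕ) : Set (TensorMat d s) :=
  {M | ∀ (x : Fin d → ℂ) (y : Fin s → ℂ),
    0 ≤ dotProduct (star (vecTensor x y)) (M.mulVec (vecTensor x y))}

/-- A set of matrices, regarded as a subset of the real vector space of Hermitian matrices. -/
def herPart {d s : ℕ} (S : Set (TensorMat d s)) : Set (HerTensor d s) :=
  {A | (A : TensorMat d s) ∈ S}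

section RealVectorSpace

/-- `S` is a convex cone: it is nonempty, convex and closed under nonnegative scaling. -/
def IsConvexCone {V : Type*} [AddCommGroup V] [Module ℝ V] (S : Set V) : Prop :=
  S.Nonempty ∧ Convex ℝ S ∧ ∀ c : ℝ, 0 ≤ c → ∀ v ∈ S, c • v ∈ S

/-- `F` is a face of `C`: a nonempty convex subset such that whenever a point of `F` lies in an
open segment between two points of `C`, these two points lie in `F`. -/
def IsConvexFace {V : Type*} [AddCommGroup V] [Module ℝ V] (C F : Set V) : Prop :=
  F.Nonempty ∧ Convex ℝ F ∧ IsExtreme ℝ C F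

/-- `F` is an exposed face of `C`: it is a face, and it is `C` itself or the zero set in `C` of
an affine linear function that is nonnegative on `C`. -/
def IsExposedFace {V : Type*} [AddCommGroup V] [Module ℝ V] (C F : Set V) : Prop :=
  IsConvexFace C F ∧
    (F = C ∨ ∃ l : V →ᵃ[ℝ] ℝ, (∀ v ∈ C, 0 ≤ l v) ∧ F = {v | v ∈ C ∧ l v = 0})

/-- Basic closed semialgebraic subsets of `ℝ^n`. -/
def IsBasicClosedSemialgebraicCoord {n : ℕ} (S : Set (Fin n → ℝ)) : Prop :=
  ∃ (r : ℕ) (p : Fin r → MvPolynomial (Fin n) ℝ),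
    S = {a | ∀ i, 0 ≤ MvPolynomial.eval a (p i)}

/-- Basic closed semialgebraic subsets of a finite-dimensional real vector space, through linear
coordinates; the choice of coordinates is immaterial, since polynomials are stable under linear
substitutions. -/
def IsBasicClosedSemialgebraic {V : Type*} [AddCommGroup V] [Module ℝ V] (S : Set V) : Prop :=
  ∃ (n : ℕ) (e : V ≃ₗ[ℝ] (Fin n → ℝ)), IsBasicClosedSemialgebraicCoord (e '' S)

/-- Classical spectrahedra in `ℝ^n`: the sets `{a | a₁ B₁ + ⋯ + aₙ Bₙ ⪰ 0}` with Hermitian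
matrices `B₁, …, Bₙ` of some common size `r`. -/
def IsSpectrahedronCoord {n : ℕ} (S : Set (Fin n → ℝ)) : Prop :=
  ∃ (r : ℕ) (B : Fin n → Matrix (Fin r) (Fin r) ℂ),
    (∀ i, (B i).IsHermitian) ∧ S = {a | (∑ i, a i • B i).PosSemidef}

/-- Classical spectrahedra in a finite-dimensional real vector space, through linear coordinates;
the choice of coordinates is immaterial. -/
def IsSpectrahedron {V : Type*} [AddCommGroup V] [Module ℝ V] (S : Set V) : Prop :=
  ∃ (n : ℕ) (e : V ≃ₗ[ℝ] (Fin n → ℝ)), IsSpectrahedronCoord (e '' S)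

end RealVectorSpace

/-!
Block positivity of `M` says that a Hermitian form is nonnegative on elementary tensors `x ⊗ y`.

*Decomposability* (`Decomp_eq_Bpsd`). Subtract from `M` the multiple of the identity that makes the
minimum of the form over products of unit vectors zero, and move a minimizer to `e₀ ⊗ e₀` by a
local congruence. In the chart `x = (T, 1)`, `y = (S, 1)` the form, a priori of degree two in each
variable together with its conjugate, is then a real quadratic polynomial
`a|T|² + b|S|² + c + 2 Re(P T̄S̄ + Q T̄S + U T̄ + W S̄)`, nonnegative on `ℂ²`. Such a polynomial has a
critical point (`exists_critical_point`), and translating this point to the origin is again a local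
congruence, which removes `U` and `W`. Choosing the phases of `T` and `S` so that both mixed terms
are negative yields `|P| + |Q| ≤ √(ab)` (`coeff_bounds_of_nonneg`). Since the partial transpose
exchanges the positions of `P` and `Q`, sharing `a` and `b` in the ratio `|Q| : |P|` writes the
matrix as a positive semidefinite one plus one with positive semidefinite partial transpose
(`xMat_mem_Decomp`).

The remaining statements are about forms with an X-shaped matrix `xMat`, written below in
the chart `x = (1, t)`, `y = (1, s)`.

*Non-exposed face.* Take the forms vanishing at `e₀ ⊗ e₀` whose Hessian there degenerates in the
direction `t = s`. A functional exposing this face vanishes on `|ts|²` and is nonnegative on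
`|ts - ε|²` for `ε > 0` and `ε < 0`, hence vanishes on `Re(ts)`. Then it also vanishes on a form
outside of the face.

*Not basic closed.* The form `c + (1 + α)(|s|² + |t|²) - 2 Re(st) + |st|²` with `|α| < 1` is
nonnegative iff `c + 2αρ + ρ² ≥ 0` for all `ρ ≥ 0`, that is, iff `c ≥ α²` for `α ≤ 0` and `c ≥ 0` for
`α ≥ 0`. So the parabola `c = α²` bounds the slice for `α < 0`, but runs through its interior for
`α > 0`. A polynomial that is nonnegative on the slice vanishes to even order along the
parabola, and is therefore nonnegative on the wrong side of the boundary, too, at generic points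
(`exists_generic_nonneg`).

*Spectrahedra* are basic closed, since a Hermitian matrix `A` is positive semidefinite iff the
characteristic polynomial of `-A` has nonnegative coefficients.
-/

open Matrix

open scoped ComplexConjugate

/-! ### Forms on elementary tensors -/

theorem vecTensor_apply {d s : ℕ} (x : Fin d → ℂ) (y : Fin s → ℂ) (p : Fin d × Fin s) :
    vecTensor x y p = x p.1 * y p.2 := rfl

theorem partialTranspose_apply {d s : ℕ} (M : TensorMat d s) (p q : Fin d × Fin s) :
    partialTranspose d s M p q = M (q.1, p.2) (p.1, q.2) := rfl

/-- The Hermitian form of `M` evaluated at the elementary tensor `x ⊗ y`. -/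
def blockForm {d s : ℕ} (M : TensorMat d s) (x : Fin d → ℂ) (y : Fin s → ℂ) : ℂ :=
  star (vecTensor x y) ⬝ᵥ M *ᵥ vecTensor x y

theorem blockForm_eq_sum {d s : ℕ} (M : TensorMat d s) (x : Fin d → ℂ) (y : Fin s → ℂ) :
    blockForm M x y =
      ∑ i, ∑ j, ∑ k, ∑ l, star (x i) * star (y j) * M (i, j) (k, l) * (x k * y l) := by
  simp only [blockForm, dotProduct, mulVec, Fintype.sum_prod_type, vecTensor_apply, Pi.star_apply,
    star_mul', Finset.mul_sum, mul_assoc]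

theorem blockForm_add {d s : ℕ} (M N : TensorMat d s) (x : Fin d → ℂ) (y : Fin s → ℂ) :
    blockForm (M + N) x y = blockForm M x y + blockForm N x y := by
  simp [blockForm, add_mulVec]

theorem blockForm_smul {d s : ℕ} (c : ℝ) (M : TensorMat d s) (x : Fin d → ℂ) (y : Fin s → ℂ) :
    blockForm (c • M) x y = c * blockForm M x y := by
  simp [blockForm, smul_mulVec]

theorem blockForm_conjTranspose {d s : ℕ} (M : TensorMat d s) (x : Fin d → ℂ) (y : Fin s → ℂ) :
    blockForm Mᴴ x y = star (blockForm M x y) := by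
  rw [blockForm, blockForm, dotProduct_mulVec, ← star_mulVec, star_dotProduct]

theorem sum_swap_first_third {d s : ℕ} (f : Fin d → Fin s → Fin d → Fin s → ℂ) :
    ∑ i, ∑ j, ∑ k, ∑ l, f i j k l = ∑ i, ∑ j, ∑ k, ∑ l, f k j i l :=
  calc _ = ∑ j, ∑ i, ∑ k, ∑ l, f i j k l := Finset.sum_comm
    _ = ∑ j, ∑ k, ∑ i, ∑ l, f i j k l := Finset.sum_congr rfl fun _ _ => Finset.sum_comm
    _ = _ := Finset.sum_comm

/-- Moving the partial transpose to the vectors conjugates the first tensor factor. -/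
theorem blockForm_partialTranspose {d s : ℕ} (M : TensorMat d s) (x : Fin d → ℂ)
    (y : Fin s → ℂ) : blockForm (partialTranspose d s M) (star x) y = blockForm M x y := by
  simp only [blockForm_eq_sum, partialTranspose_apply, Pi.star_apply, star_star]
  rw [sum_swap_first_third]
  refine Finset.sum_congr rfl fun i _ => Finset.sum_congr rfl fun j _ =>
    Finset.sum_congr rfl fun k _ => Finset.sum_congr rfl fun l _ => ?_
  ring

theorem isHermitian_of_partialTranspose {d s : ℕ} {M : TensorMat d s}
    (h : (partialTranspose d s M).IsHermitian) : M.IsHermitian := by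
  ext p q
  have := congrFun (congrFun h (q.1, p.2)) (p.1, q.2)
  simpa [partialTranspose_apply] using this

theorem isHermitian_of_mem_Decomp {d s : ℕ} {M : TensorMat d s} (h : M ∈ Decomp d s) :
    M.IsHermitian := by
  obtain ⟨X, hX, Y, hY, rfl⟩ := h
  exact IsHermitian.add (PosSemidef.isHermitian hX)
    (isHermitian_of_partialTranspose (PosSemidef.isHermitian hY))

theorem Decomp_subset_Bpsd (d s : ℕ) : Decomp d s ⊆ Bpsd d s := by
  rintro _ ⟨X, hX, Y, hY, rfl⟩ x y
  change 0 ≤ blockForm (X + Y) x y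
  rw [blockForm_add, ← blockForm_partialTranspose Y]
  exact add_nonneg (PosSemidef.dotProduct_mulVec_nonneg hX _)
    (PosSemidef.dotProduct_mulVec_nonneg hY _)

theorem add_mem_Decomp {d s : ℕ} {M N : TensorMat d s} (hM : M ∈ Decomp d s)
    (hN : N ∈ Decomp d s) : M + N ∈ Decomp d s := by
  obtain ⟨X, hX, Y, hY, rfl⟩ := hM
  obtain ⟨X', hX', Y', hY', rfl⟩ := hN
  refine ⟨X + X', PosSemidef.add hX hX', Y + Y', ?_, by abel⟩
  change (partialTranspose d s (Y + Y')).PosSemidef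
  rw [map_add]
  exact PosSemidef.add hY hY'

theorem mem_Decomp_of_posSemidef {d s : ℕ} {M : TensorMat d s} (h : M.PosSemidef) :
    M ∈ Decomp d s :=
  ⟨M, h, 0, by simp [PsdGamma, PosSemidef.zero], by simp⟩

theorem mem_Decomp_of_partialTranspose {d s : ℕ} {M : TensorMat d s}
    (h : (partialTranspose d s M).PosSemidef) : M ∈ Decomp d s :=
  ⟨0, PosSemidef.zero, M, h, by simp⟩

/-! ### Local congruences -/

/-- The congruence of `M` by the local operator `A ⊗ B`. -/
def localCongr {d s : ℕ} (A : Matrix (Fin d) (Fin d) ℂ) (B : Matrix (Fin s) (Fin s) ℂ)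
    (M : TensorMat d s) : TensorMat d s :=
  (A ⊗ₖ B)ᴴ * M * (A ⊗ₖ B)

theorem kronecker_mulVec_vecTensor {d s : ℕ} (A : Matrix (Fin d) (Fin d) ℂ)
    (B : Matrix (Fin s) (Fin s) ℂ) (x : Fin d → ℂ) (y : Fin s → ℂ) :
    (A ⊗ₖ B) *ᵥ vecTensor x y = vecTensor (A *ᵥ x) (B *ᵥ y) := by
  ext ⟨i, j⟩
  simp only [mulVec, dotProduct, vecTensor_apply, Fintype.sum_prod_type, kroneckerMap_apply,
    Finset.sum_mul_sum]
  refine Finset.sum_congr rfl fun k _ => Finset.sum_congr rfl fun l _ => ?_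
  ring

theorem blockForm_localCongr {d s : ℕ} (A : Matrix (Fin d) (Fin d) ℂ)
    (B : Matrix (Fin s) (Fin s) ℂ) (M : TensorMat d s) (x : Fin d → ℂ) (y : Fin s → ℂ) :
    blockForm (localCongr A B M) x y = blockForm M (A *ᵥ x) (B *ᵥ y) := by
  rw [blockForm, blockForm, localCongr, ← kronecker_mulVec_vecTensor, star_mulVec,
    ← mulVec_mulVec, ← mulVec_mulVec, dotProduct_mulVec]

theorem localCongr_apply {d s : ℕ} (A : Matrix (Fin d) (Fin d) ℂ)
    (B : Matrix (Fin s) (Fin s) ℂ) (M : TensorMat d s) (p q : Fin d × Fin s) :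
    localCongr A B M p q = ∑ i, ∑ j, ∑ k, ∑ l,
      star (A k p.1) * star (B l p.2) * M (k, l) (i, j) * (A i q.1 * B j q.2) := by
  simp only [localCongr, mul_apply, Fintype.sum_prod_type, conjTranspose_apply,
    kroneckerMap_apply, star_mul', Finset.sum_mul]

theorem partialTranspose_localCongr {d s : ℕ} (A : Matrix (Fin d) (Fin d) ℂ)
    (B : Matrix (Fin s) (Fin s) ℂ) (M : TensorMat d s) :
    partialTranspose d s (localCongr A B M) =
      localCongr (A.map star) B (partialTranspose d s M) := by
  ext p q
  simp only [partialTranspose_apply, localCongr_apply, map_apply, star_star]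
  rw [sum_swap_first_third]
  refine Finset.sum_congr rfl fun i _ => Finset.sum_congr rfl fun j _ =>
    Finset.sum_congr rfl fun k _ => Finset.sum_congr rfl fun l _ => ?_
  ring

theorem localCongr_mem_Bpsd {d s : ℕ} {M : TensorMat d s} (h : M ∈ Bpsd d s)
    (A : Matrix (Fin d) (Fin d) ℂ) (B : Matrix (Fin s) (Fin s) ℂ) :
    localCongr A B M ∈ Bpsd d s := fun x y => by
  change 0 ≤ blockForm _ x y
  rw [blockForm_localCongr]
  exact h _ _

theorem localCongr_mem_Decomp {d s : ℕ} {M : TensorMat d s} (h : M ∈ Decomp d s)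
    (A : Matrix (Fin d) (Fin d) ℂ) (B : Matrix (Fin s) (Fin s) ℂ) :
    localCongr A B M ∈ Decomp d s := by
  obtain ⟨X, hX, Y, hY, rfl⟩ := h
  refine ⟨localCongr A B X, PosSemidef.conjTranspose_mul_mul_same hX _, localCongr A B Y, ?_, ?_⟩
  · change (partialTranspose d s (localCongr A B Y)).PosSemidef
    rw [partialTranspose_localCongr]
    exact PosSemidef.conjTranspose_mul_mul_same hY _
  · simp [localCongr, Matrix.mul_add, Matrix.add_mul]

theorem localCongr_localCongr {d s : ℕ} (A A' : Matrix (Fin d) (Fin d) ℂ)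
    (B B' : Matrix (Fin s) (Fin s) ℂ) (M : TensorMat d s) :
    localCongr A' B' (localCongr A B M) = localCongr (A * A') (B * B') M := by
  simp only [localCongr, mul_kronecker_mul, conjTranspose_mul, Matrix.mul_assoc]

/-- Invertible local congruences reflect decomposability. -/
theorem mem_Decomp_of_localCongr {d s : ℕ} {M : TensorMat d s}
    {A A' : Matrix (Fin d) (Fin d) ℂ} {B B' : Matrix (Fin s) (Fin s) ℂ}
    (hA : A * A' = 1) (hB : B * B' = 1) (h : localCongr A B M ∈ Decomp d s) :
    M ∈ Decomp d s := by
  have := localCongr_mem_Decomp h A' B'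
  rw [localCongr_localCongr, hA, hB] at this
  simpa [localCongr] using this

/-! ### Block positive matrices are Hermitian -/

theorem eq_zero_of_sesquilinear_diag {n : Fin 2 → Fin 2 → ℂ}
    (h : ∀ x : Fin 2 → ℂ, ∑ i, ∑ k, star (x i) * n i k * x k = 0) (i k : Fin 2) : n i k = 0 := by
  have h0 := h ![1, 0]
  have h1 := h ![0, 1]
  have h2 := h ![1, 1]
  have h3 := h ![1, Complex.I]
  simp [Fin.sum_univ_two] at h0 h1 h2 h3
  simp only [h0, h1, zero_add, add_zero, mul_zero, zero_mul] at h2 h3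
  have h4 : n 0 1 - n 1 0 = 0 := by
    linear_combination (-Complex.I) * h3 + (n 0 1 - n 1 0) * Complex.I_sq
  have h5 : n 0 1 = 0 := by linear_combination (h2 + h4) / 2
  have h6 : n 1 0 = 0 := by linear_combination (h2 - h4) / 2
  fin_cases i <;> fin_cases k <;> simpa

theorem eq_zero_of_blockForm_eq_zero {N : TensorMat 2 2} (h : ∀ x y, blockForm N x y = 0) :
    N = 0 := by
  have key : ∀ (y : Fin 2 → ℂ) (i k : Fin 2),
      ∑ j, ∑ l, star (y j) * N (i, j) (k, l) * y l = 0 := by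
    intro y
    refine eq_zero_of_sesquilinear_diag
      (n := fun i k => ∑ j, ∑ l, star (y j) * N (i, j) (k, l) * y l) fun x => ?_
    rw [← h x y, blockForm_eq_sum]
    simp only [Fin.sum_univ_two]
    ring
  ext ⟨i, j⟩ ⟨k, l⟩
  exact eq_zero_of_sesquilinear_diag (n := fun j l => N (i, j) (k, l)) (fun y => key y i k) j l

theorem isHermitian_of_mem_Bpsd {M : TensorMat 2 2} (h : M ∈ Bpsd 2 2) : M.IsHermitian := by
  refine sub_eq_zero.mp (eq_zero_of_blockForm_eq_zero (N := Mᴴ - M) fun x y => ?_)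
  have h1 : blockForm (Mᴴ - M) x y = blockForm Mᴴ x y - blockForm M x y := by
    simp [blockForm, sub_mulVec]
  have h2 : star (blockForm M x y) = blockForm M x y := (IsSelfAdjoint.of_nonneg (h x y)).star_eq
  rw [h1, blockForm_conjTranspose, h2, sub_self]

/-! ### Nonnegative real quadratic polynomials -/

theorem nonneg_of_forall_sq_mul_add {q c : ℝ} (h : ∀ r : ℝ, 0 ≤ r ^ 2 * q + c) : 0 ≤ q := by
  by_contra! hq
  have h1 := h ((|c| + 1) / (-q) + 1)
  have h2 : (|c| + 1) / (-q) * q = -(|c| + 1) := by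
    rw [div_neg, neg_mul, div_mul_cancel₀ _ hq.ne]
  have h3 : 0 ≤ (|c| + 1) / (-q) := by
    apply div_nonneg <;> linarith [abs_nonneg c]
  have h4 := le_abs_self c
  nlinarith [abs_nonneg c]

theorem eq_zero_of_forall_mul_add {q c : ℝ} (h : ∀ r : ℝ, 0 ≤ r * q + c) : q = 0 := by
  by_contra hq
  have := h (-(|c| + 1) / q)
  rw [div_mul_cancel₀ _ hq] at this
  linarith [le_abs_self c]

/-- A linear functional that vanishes on the kernel of a symmetric bilinear form is represented
by that form. -/
theorem exists_represents_of_ker_le {V : Type*} [AddCommGroup V] [Module ℝ V]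
    [FiniteDimensional ℝ V] (B : V →ₗ[ℝ] Module.Dual ℝ V) (hB : ∀ v w, B v w = B w v)
    (l : Module.Dual ℝ V) (hl : ∀ v, B v = 0 → l v = 0) : ∃ v, B v = l := by
  by_contra h
  obtain ⟨f, hf, hle⟩ := Submodule.exists_le_ker_of_notMem (p := B.range) (v := l) h
  obtain ⟨v, rfl⟩ := (Module.evalEquiv ℝ V).surjective f
  refine hf (hl v ?_)
  ext w
  rw [hB]
  exact hle ⟨w, rfl⟩

/-- A nonnegative real quadratic polynomial in two complex variables `T`, `S` without `T²` and
`S²` terms has a critical point. -/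
theorem exists_critical_point {a b c : ℝ} {P Q U W : ℂ}
    (h : ∀ T S : ℂ, 0 ≤ a * Complex.normSq T + b * Complex.normSq S + c +
      2 * (conj T * conj S * P + conj T * S * Q + conj T * U + conj S * W).re) :
    ∃ T S : ℂ, a * T + P * conj S + Q * S + U = 0 ∧ b * S + P * conj T + conj Q * T + W = 0 := by
  let B : (ℂ × ℂ) →ₗ[ℝ] Module.Dual ℝ (ℂ × ℂ) := LinearMap.mk₂ ℝ
    (fun v w => (conj w.1 * (a * v.1 + P * conj v.2 + Q * v.2) +
      conj w.2 * (b * v.2 + P * conj v.1 + conj Q * v.1)).re)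
    (by intros; simp; ring) (by intros; simp; ring) (by intros; simp; ring)
    (by intros; simp; ring)
  have hBdef : ∀ v w : ℂ × ℂ, B v w = (conj w.1 * (a * v.1 + P * conj v.2 + Q * v.2) +
      conj w.2 * (b * v.2 + P * conj v.1 + conj Q * v.1)).re := fun _ _ => rfl
  let l : Module.Dual ℝ (ℂ × ℂ) :=
    { toFun := fun w => -(conj w.1 * U + conj w.2 * W).re
      map_add' := by intros; simp; ring
      map_smul' := by intros; simp; ring }
  have hldef : ∀ w : ℂ × ℂ, l w = -(conj w.1 * U + conj w.2 * W).re := fun _ => rfl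
  obtain ⟨⟨T, S⟩, hv⟩ := exists_represents_of_ker_le B
    (by
      intro v w
      rw [hBdef, hBdef]
      simp
      ring) l (by
      rintro ⟨T, S⟩ hv
      have h0 : B (T, S) (T, S) = 0 := by rw [hv]; rfl
      rw [hBdef] at h0
      rw [hldef, neg_eq_zero]
      refine eq_zero_of_forall_mul_add (c := c / 2) fun r => ?_
      have h1 := h (r * T) (r * S)
      simp [Complex.normSq_apply] at h0 h1 ⊢
      linear_combination (1 / 2) * h1 + (r ^ 2 / 2) * h0)
  refine ⟨T, S, ?_⟩
  set E := (a * T + P * conj S + Q * S + U : ℂ) with hE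
  set G := (b * S + P * conj T + conj Q * T + W : ℂ) with hG
  have h1 : B (T, S) (E, G) = l (E, G) := by rw [hv]
  have h2 : Complex.normSq E + Complex.normSq G = 0 := by
    have h3 : (conj E * E + conj G * G).re = 0 := by
      rw [hBdef, hldef] at h1
      rw [eq_neg_iff_add_eq_zero, ← Complex.add_re] at h1
      rw [← h1]
      congr 1
      simp only [hE, hG]
      ring
    rw [← h3]
    simp [Complex.normSq_apply]
  have h4 := Complex.normSq_nonneg E
  have h5 := Complex.normSq_nonneg G
  exact ⟨Complex.normSq_eq_zero.mp (by linarith), Complex.normSq_eq_zero.mp (by linarith)⟩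

/-- The phases of `T` and `S` can be chosen so that both mixed terms are negative; hence the
coefficients of a nonnegative polynomial satisfy `|P| + |Q| ≤ √(ab)`. -/
theorem coeff_bounds_of_nonneg {a b c : ℝ} {P Q : ℂ}
    (h : ∀ T S : ℂ, 0 ≤ a * Complex.normSq T + b * Complex.normSq S + c +
      2 * (conj T * conj S * P + conj T * S * Q).re) :
    0 ≤ a ∧ 0 ≤ b ∧ 0 ≤ c ∧ (‖P‖ + ‖Q‖) ^ 2 ≤ a * b := by
  have ha : 0 ≤ a := nonneg_of_forall_sq_mul_add (c := c) fun r => by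
    simpa [Complex.normSq_apply, mul_comm, sq] using h r 0
  have hb : 0 ≤ b := nonneg_of_forall_sq_mul_add (c := c) fun r => by
    simpa [Complex.normSq_apply, mul_comm, sq] using h 0 r
  have hc : 0 ≤ c := by simpa using h 0 0
  refine ⟨ha, hb, hc, ?_⟩
  set k := ‖P‖ + ‖Q‖ with hk
  have hk0 : 0 ≤ k := by positivity
  have key : ∀ r t : ℝ, 0 ≤ a * r ^ 2 + b * t ^ 2 - 2 * r * t * k := by
    intro r t
    refine nonneg_of_forall_sq_mul_add (c := c) fun u => ?_
    let φ := P.arg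
    let ψ := Q.arg
    have hP : (‖P‖ : ℂ) * Complex.exp (φ * Complex.I) = P := Complex.norm_mul_exp_arg_mul_I P
    have hQ : (‖Q‖ : ℂ) * Complex.exp (ψ * Complex.I) = Q := Complex.norm_mul_exp_arg_mul_I Q
    have e1 : ∀ z : ℝ, conj (Complex.exp (z * Complex.I)) = Complex.exp (-(z * Complex.I)) := by
      intro z
      rw [← Complex.exp_conj]
      simp
    have e2 : ∀ z : ℝ, Complex.normSq (Complex.exp (z * Complex.I)) = 1 := by
      intro z
      rw [Complex.normSq_eq_norm_sq, Complex.norm_exp_ofReal_mul_I, one_pow]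
    have h1 := h (((-(u * r) : ℝ) : ℂ) * Complex.exp (((φ + ψ) / 2 : ℝ) * Complex.I))
      (((u * t : ℝ) : ℂ) * Complex.exp (((φ - ψ) / 2 : ℝ) * Complex.I))
    have h2 : conj (Complex.exp (((φ + ψ) / 2 : ℝ) * Complex.I)) *
        conj (Complex.exp (((φ - ψ) / 2 : ℝ) * Complex.I)) * P = ‖P‖ := by
      rw [e1, e1, ← Complex.exp_add]
      conv_lhs => rw [← hP]
      rw [mul_left_comm, ← Complex.exp_add]
      convert mul_one (‖P‖ : ℂ)
      rw [← Complex.exp_zero]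
      congr 1
      push_cast
      ring
    have h3 : conj (Complex.exp (((φ + ψ) / 2 : ℝ) * Complex.I)) *
        Complex.exp (((φ - ψ) / 2 : ℝ) * Complex.I) * Q = ‖Q‖ := by
      rw [e1, ← Complex.exp_add]
      conv_lhs => rw [← hQ]
      rw [mul_left_comm, ← Complex.exp_add]
      convert mul_one (‖Q‖ : ℂ)
      rw [← Complex.exp_zero]
      congr 1
      push_cast
      ring
    simp only [map_mul, Complex.conj_ofReal, e2, Complex.normSq_ofReal] at h1
    have h4 : ∀ x y z w v : ℂ, x * z * (y * w) * v = x * y * (z * w * v) := by intros; ring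
    rw [h4, h4, h2, h3] at h1
    have h5 : ((((-(u * r) : ℝ) : ℂ) * ((u * t : ℝ) : ℂ) * (‖P‖ : ℂ) +
        ((-(u * r) : ℝ) : ℂ) * ((u * t : ℝ) : ℂ) * (‖Q‖ : ℂ))).re =
        -(u * r) * (u * t) * k := by
      rw [hk, mul_add, Complex.add_re]
      simp only [← Complex.ofReal_mul, Complex.ofReal_re]
    rw [h5] at h1
    linarith
  rcases hb.eq_or_lt with rfl | hb
  · have : 2 * k = 0 := by
      refine eq_zero_of_forall_mul_add (c := a) fun r => ?_
      have := key 1 (-r)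
      linarith
    have : k = 0 := by linarith
    simp [this]
  · have := key b k
    have h1 : 0 ≤ b * (a * b - k ^ 2) := by linarith
    have := (mul_nonneg_iff_of_pos_left hb).mp h1
    linarith

/-! ### X-shaped matrices -/

/-- The matrix supported on the index pair `i`, `j`, with diagonal entries `a`, `b` and
off-diagonal entry `z` at `(i, j)`. -/
def twoBlock {n : Type*} [DecidableEq n] (i j : n) (a b : ℝ) (z : ℂ) : Matrix n n ℂ :=
  single i i (a : ℂ) + single j j (b : ℂ) + single i j z + single j i (conj z)

theorem form_single {n : Type*} [Fintype n] [DecidableEq n] (i j : n) (z : ℂ) (x : n → ℂ) :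
    star x ⬝ᵥ single i j z *ᵥ x = conj (x i) * z * x j := by
  rw [single_mulVec, dotProduct_comm]
  simp [dotProduct, Function.update_apply]
  ring

theorem form_twoBlock {n : Type*} [Fintype n] [DecidableEq n] (i j : n) (a b : ℝ) (z : ℂ)
    (x : n → ℂ) :
    star x ⬝ᵥ twoBlock i j a b z *ᵥ x =
      (a * Complex.normSq (x i) + b * Complex.normSq (x j) +
        2 * (conj (x i) * z * x j).re : ℝ) := by
  simp only [twoBlock, add_mulVec, dotProduct_add, form_single]
  apply Complex.ext
  · simp [Complex.normSq_apply]
    ring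
  · simp
    ring

theorem twoBlock_isHermitian {n : Type*} [DecidableEq n] (i j : n) (a b : ℝ) (z : ℂ) :
    (twoBlock i j a b z).IsHermitian := by
  simp only [IsHermitian, twoBlock, conjTranspose_add, conjTranspose_single]
  simp
  abel

theorem posSemidef_twoBlock {n : Type*} [Fintype n] [DecidableEq n] (i j : n) {a b : ℝ} {z : ℂ}
    (ha : 0 ≤ a) (hb : 0 ≤ b) (hz : ‖z‖ ^ 2 ≤ a * b) : (twoBlock i j a b z).PosSemidef := by
  refine .of_dotProduct_mulVec_nonneg (twoBlock_isHermitian i j a b z) fun x => ?_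
  rw [form_twoBlock, Complex.zero_le_real]
  have h1 : -(‖x i‖ * ‖z‖ * ‖x j‖) ≤ (conj (x i) * z * x j).re := by
    have := Complex.abs_re_le_norm (conj (x i) * z * x j)
    simp only [norm_mul, Complex.norm_conj] at this
    exact (abs_le.mp this).1
  rw [Complex.normSq_eq_norm_sq, Complex.normSq_eq_norm_sq]
  suffices 0 ≤ a * ‖x i‖ ^ 2 + b * ‖x j‖ ^ 2 - 2 * (‖x i‖ * ‖z‖ * ‖x j‖) by linarith
  rcases ha.eq_or_lt with rfl | ha
  · have : ‖z‖ = 0 := by nlinarith [norm_nonneg z]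
    rw [this]
    simp only [zero_mul, mul_zero, sub_zero, zero_add]
    positivity
  · refine (mul_nonneg_iff_of_pos_left ha).mp ?_
    have : 0 ≤ (a * b - ‖z‖ ^ 2) * ‖x j‖ ^ 2 := mul_nonneg (by linarith) (sq_nonneg _)
    nlinarith [sq_nonneg (a * ‖x i‖ - ‖z‖ * ‖x j‖)]

/-- The X-shaped Hermitian matrix with diagonal `c, a, b, d` (in lexicographic order) and
antidiagonal entries `p`, `q` in its first two rows. -/
def xMat (c a b d : ℝ) (p q : ℂ) : TensorMat 2 2 :=
  twoBlock (0, 0) (1, 1) c d p + twoBlock (0, 1) (1, 0) a b q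

theorem xMat_isHermitian (c a b d : ℝ) (p q : ℂ) : (xMat c a b d p q).IsHermitian :=
  (twoBlock_isHermitian _ _ _ _ _).add (twoBlock_isHermitian _ _ _ _ _)

theorem xMat_posSemidef {c a b d : ℝ} {p q : ℂ} (hc : 0 ≤ c) (ha : 0 ≤ a) (hb : 0 ≤ b)
    (hd : 0 ≤ d) (hp : ‖p‖ ^ 2 ≤ c * d) (hq : ‖q‖ ^ 2 ≤ a * b) :
    (xMat c a b d p q).PosSemidef :=
  (posSemidef_twoBlock _ _ hc hd hp).add (posSemidef_twoBlock _ _ ha hb hq)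

theorem xMat_apply (c a b d : ℝ) (p q : ℂ) (i j k l : Fin 2) :
    xMat c a b d p q (i, j) (k, l) =
      if i = k ∧ j = l then !![(c : ℂ), a; b, d] i j
      else if i ≠ k ∧ j ≠ l then !![p, q; conj q, conj p] i j else 0 := by
  fin_cases i <;> fin_cases j <;> fin_cases k <;> fin_cases l <;>
    simp [xMat, twoBlock]

theorem partialTranspose_xMat (c a b d : ℝ) (p q : ℂ) :
    partialTranspose 2 2 (xMat c a b d p q) = xMat c a b d (conj q) (conj p) := by
  ext ⟨i, j⟩ ⟨k, l⟩
  rw [partialTranspose_apply, xMat_apply, xMat_apply]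
  fin_cases i <;> fin_cases j <;> fin_cases k <;> fin_cases l <;> simp

theorem xMat_add (c a b d : ℝ) (p q : ℂ) (c' a' b' d' : ℝ) (p' q' : ℂ) :
    xMat c a b d p q + xMat c' a' b' d' p' q' =
      xMat (c + c') (a + a') (b + b') (d + d') (p + p') (q + q') := by
  simp only [xMat, twoBlock, Complex.ofReal_add, map_add, single_add]
  abel

theorem blockForm_xMat (c a b d : ℝ) (p q : ℂ) (x y : Fin 2 → ℂ) :
    blockForm (xMat c a b d p q) x y =
      (c * Complex.normSq (x 0 * y 0) + a * Complex.normSq (x 0 * y 1) +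
        b * Complex.normSq (x 1 * y 0) + d * Complex.normSq (x 1 * y 1) +
        2 * (conj (x 0 * y 0) * p * (x 1 * y 1) + conj (x 0 * y 1) * q * (x 1 * y 0)).re : ℝ) := by
  simp only [blockForm, xMat, add_mulVec, dotProduct_add, form_twoBlock, vecTensor_apply,
    ← Complex.ofReal_add, Complex.add_re]
  congr 1
  ring

/-! ### Block positive matrices are decomposable -/

/-- The entries `p` and `q` are exchanged by the partial transpose, so the X-shaped matrix is
decomposable as soon as its middle diagonal entries can be shared between them. -/
theorem xMat_mem_Decomp {a b d : ℝ} {p q : ℂ} (ha : 0 ≤ a) (hb : 0 ≤ b) (hd : 0 ≤ d)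
    (h : (‖p‖ + ‖q‖) ^ 2 ≤ a * b) : xMat 0 a b d p q ∈ Decomp 2 2 := by
  set k := ‖p‖ + ‖q‖ with hk
  have hp := norm_nonneg p
  have hq := norm_nonneg q
  have hk0 : 0 ≤ k := by positivity
  -- The weights `u` and `v` of the two summands are proportional to `|q|` and `|p|`.
  obtain ⟨u, v, hu, hv, huv, huq, hvp⟩ : ∃ u v : ℝ, 0 ≤ u ∧ 0 ≤ v ∧ u + v = 1 ∧
      ‖q‖ = u * k ∧ ‖p‖ = v * k := by
    rcases hk0.eq_or_lt with h0 | h0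
    · exact ⟨1, 0, by norm_num, by norm_num, by norm_num, by linarith, by linarith⟩
    · refine ⟨‖q‖ / k, ‖p‖ / k, by positivity, by positivity, ?_, ?_, ?_⟩
      · field_simp
        linarith
      · field_simp
      · field_simp
  have hsplit : xMat 0 a b d p q =
      xMat 0 (u * a) (u * b) d 0 q + xMat 0 (v * a) (v * b) 0 p 0 := by
    rw [xMat_add]
    congr 1
    · simp
    · rw [← add_mul, huv, one_mul]
    · rw [← add_mul, huv, one_mul]
    · simp
    · simp
    · simp
  rw [hsplit]
  refine add_mem_Decomp (mem_Decomp_of_posSemidef ?_) (mem_Decomp_of_partialTranspose ?_)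
  · refine xMat_posSemidef le_rfl (by positivity) (by positivity) hd (by simp) ?_
    rw [huq]
    nlinarith [mul_le_mul_of_nonneg_left h (sq_nonneg u)]
  · rw [partialTranspose_xMat]
    refine xMat_posSemidef le_rfl (by positivity) (by positivity) le_rfl (by simp) ?_
    rw [Complex.norm_conj, hvp]
    nlinarith [mul_le_mul_of_nonneg_left h (sq_nonneg v)]

theorem eq_zero_of_forall_conj_mul_re {m : ℂ} {d : ℝ} (h : ∀ z : ℂ, 0 ≤ 2 * (conj z * m).re + d) :
    m = 0 := by
  rw [← Complex.normSq_eq_zero]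
  refine eq_zero_of_forall_mul_add (c := d / 2) fun r => ?_
  have := h (r * m)
  simp [Complex.normSq_apply] at this ⊢
  linarith

/-- If the form of a block positive matrix vanishes at `e₀ ⊗ e₀`, then so does its derivative in
the two local directions. -/
theorem corner_entries_eq_zero {M : TensorMat 2 2} (h : M ∈ Bpsd 2 2)
    (h0 : M (0, 0) (0, 0) = 0) : M (0, 0) (0, 1) = 0 ∧ M (0, 0) (1, 0) = 0 := by
  have hH := isHermitian_of_mem_Bpsd h
  constructor
  · refine eq_zero_of_forall_conj_mul_re (d := (M (0, 1) (0, 1)).re) fun z => ?_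
    have h1 := (Complex.nonneg_iff.mp (h ![1, 0] ![z, 1])).1
    change 0 ≤ (blockForm M _ _).re at h1
    rw [blockForm_eq_sum] at h1
    have h2 : M (0, 1) (0, 0) = conj (M (0, 0) (0, 1)) := (hH.apply _ _).symm
    simp [Fin.sum_univ_two, h0, h2] at h1 ⊢
    linarith
  · refine eq_zero_of_forall_conj_mul_re (d := (M (1, 0) (1, 0)).re) fun z => ?_
    have h1 := (Complex.nonneg_iff.mp (h ![z, 1] ![1, 0])).1
    change 0 ≤ (blockForm M _ _).re at h1
    rw [blockForm_eq_sum] at h1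
    have h2 : M (1, 0) (0, 0) = conj (M (0, 0) (1, 0)) := (hH.apply _ _).symm
    simp [Fin.sum_univ_two, h0, h2] at h1 ⊢
    linarith

theorem eq_xMat_of_entries {M : TensorMat 2 2} (hH : M.IsHermitian) (h0 : M (0, 0) (0, 0) = 0)
    (h1 : M (0, 0) (0, 1) = 0) (h2 : M (0, 0) (1, 0) = 0) (h3 : M (0, 1) (1, 1) = 0)
    (h4 : M (1, 0) (1, 1) = 0) :
    M = xMat 0 (M (0, 1) (0, 1)).re (M (1, 0) (1, 0)).re (M (1, 1) (1, 1)).re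
      (M (0, 0) (1, 1)) (M (0, 1) (1, 0)) := by
  have hc : ∀ p q, M p q = conj (M q p) := fun p q => (hH.apply _ _).symm
  have hd : ∀ p, ((M p p).re : ℂ) = M p p := fun p => Complex.conj_eq_iff_re.mp (hc p p).symm
  ext ⟨i, j⟩ ⟨k, l⟩
  rw [xMat_apply]
  fin_cases i <;> fin_cases j <;> fin_cases k <;> fin_cases l <;>
    simp [hd, h0, h1, h2, h3, h4, hc (0, 1) (0, 0), hc (1, 0) (0, 0), hc (1, 1) (0, 1),
      hc (1, 1) (1, 0), ← hc (1, 1) (0, 0), ← hc (1, 0) (0, 1)]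

/-- A block positive matrix whose form vanishes at `e₀ ⊗ e₀` becomes, in the affine chart
`(T, 1) ⊗ (S, 1)`, a nonnegative real quadratic polynomial. Translating its critical point to the
origin is a local congruence, and makes the matrix X-shaped. -/
theorem mem_Decomp_of_corner_eq_zero {M : TensorMat 2 2} (h : M ∈ Bpsd 2 2)
    (h0 : M (0, 0) (0, 0) = 0) : M ∈ Decomp 2 2 := by
  have hH := isHermitian_of_mem_Bpsd h
  have hc : ∀ p q, M p q = conj (M q p) := fun p q => (hH.apply _ _).symm
  have hd : ∀ p, (M p p).im = 0 := fun p => Complex.conj_eq_iff_im.mp (hc p p).symm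
  obtain ⟨h1, h2⟩ := corner_entries_eq_zero h h0
  have h1' : M (0, 1) (0, 0) = 0 := by rw [hc, h1, map_zero]
  have h2' : M (1, 0) (0, 0) = 0 := by rw [hc, h2, map_zero]
  obtain ⟨T, S, hT, hS⟩ := exists_critical_point (a := (M (0, 1) (0, 1)).re)
    (b := (M (1, 0) (1, 0)).re) (c := (M (1, 1) (1, 1)).re) (P := M (0, 0) (1, 1))
    (Q := M (0, 1) (1, 0)) (U := M (0, 1) (1, 1)) (W := M (1, 0) (1, 1)) (by
      intro T S
      have h3 := (Complex.nonneg_iff.mp (h ![T, 1] ![S, 1])).1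
      change 0 ≤ (blockForm M _ _).re at h3
      rw [blockForm_eq_sum] at h3
      simp [Fin.sum_univ_two, h0, h1, h2, h1', h2', hc (1, 1) (0, 0), hc (1, 1) (0, 1),
        hc (1, 1) (1, 0), hc (1, 0) (0, 1), Complex.normSq_apply, hd] at h3 ⊢
      linarith)
  have hd' : ∀ p, ((M p p).re : ℂ) = M p p := fun p => Complex.conj_eq_iff_re.mp (hc p p).symm
  rw [hd'] at hT hS
  set A : Matrix (Fin 2) (Fin 2) ℂ := !![1, T; 0, 1] with hA
  set B : Matrix (Fin 2) (Fin 2) ℂ := !![1, S; 0, 1] with hB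
  have hAA : A * !![1, -T; 0, 1] = 1 := by
    rw [hA, mul_fin_two, one_fin_two]
    simp
  have hBB : B * !![1, -S; 0, 1] = 1 := by
    rw [hB, mul_fin_two, one_fin_two]
    simp
  refine mem_Decomp_of_localCongr hAA hBB ?_
  have hN := localCongr_mem_Bpsd h A B
  have hN0 : localCongr A B M (0, 0) (0, 0) = 0 := by
    simp [localCongr_apply, Fin.sum_univ_two, hA, hB, h0]
  have hN3 : localCongr A B M (0, 1) (1, 1) = 0 := by
    simp [localCongr_apply, Fin.sum_univ_two, hA, hB, h0, h1, h2, h1']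
    linear_combination hT
  have hN4 : localCongr A B M (1, 0) (1, 1) = 0 := by
    simp [localCongr_apply, Fin.sum_univ_two, hA, hB, h0, h1, h2, h2', hc (1, 0) (0, 1)]
    linear_combination hS
  obtain ⟨hN1, hN2⟩ := corner_entries_eq_zero hN hN0
  have hX := eq_xMat_of_entries (isHermitian_of_mem_Bpsd hN) hN0 hN1 hN2 hN3 hN4
  rw [hX] at hN ⊢
  obtain ⟨ha, hb, hc, hab⟩ := coeff_bounds_of_nonneg (a := (localCongr A B M (0, 1) (0, 1)).re)
    (b := (localCongr A B M (1, 0) (1, 0)).re) (c := (localCongr A B M (1, 1) (1, 1)).re)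
    (P := localCongr A B M (0, 0) (1, 1)) (Q := localCongr A B M (0, 1) (1, 0)) (by
      intro T S
      have h3 := hN ![T, 1] ![S, 1]
      change 0 ≤ blockForm _ _ _ at h3
      rw [blockForm_xMat, Complex.zero_le_real] at h3
      simpa [mul_right_comm] using h3)
  exact xMat_mem_Decomp ha hb hc hab

theorem exists_min_blockForm (M : TensorMat 2 2) :
    ∃ x y : Fin 2 → ℂ, star x ⬝ᵥ x = 1 ∧ star y ⬝ᵥ y = 1 ∧ ∀ x' y' : Fin 2 → ℂ,
      star x' ⬝ᵥ x' = 1 → star y' ⬝ᵥ y' = 1 → (blockForm M x y).re ≤ (blockForm M x' y').re := by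
  have hnorm : ∀ x : EuclideanSpace ℂ (Fin 2),
      x ∈ Metric.sphere (0 : EuclideanSpace ℂ (Fin 2)) 1 ↔ star x.ofLp ⬝ᵥ x.ofLp = 1 := by
    intro x
    rw [mem_sphere_zero_iff_norm, ← sq_eq_sq₀ (norm_nonneg _) zero_le_one,
      EuclideanSpace.norm_sq_eq, ← Complex.ofReal_inj]
    simp [dotProduct, Complex.conj_mul']
  have hcont : Continuous fun z : EuclideanSpace ℂ (Fin 2) × EuclideanSpace ℂ (Fin 2) =>
      (blockForm M z.1.ofLp z.2.ofLp).re := by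
    simp only [blockForm_eq_sum]
    fun_prop
  have hK : IsCompact (Metric.sphere (0 : EuclideanSpace ℂ (Fin 2)) 1) := isCompact_sphere _ _
  have hne : (Metric.sphere (0 : EuclideanSpace ℂ (Fin 2)) 1).Nonempty :=
    NormedSpace.sphere_nonempty.mpr zero_le_one
  obtain ⟨z, hz, hmin⟩ := (hK.prod hK).exists_isMinOn (hne.prod hne) hcont.continuousOn
  refine ⟨z.1.ofLp, z.2.ofLp, (hnorm _).mp hz.1, (hnorm _).mp hz.2, fun x' y' hx' hy' => ?_⟩
  exact isMinOn_iff.mp hmin (WithLp.toLp 2 x', WithLp.toLp 2 y')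
    (Set.mk_mem_prod ((hnorm _).mpr hx') ((hnorm _).mpr hy'))

theorem exists_matrix_with_first_column {x : Fin 2 → ℂ} (hx : star x ⬝ᵥ x = 1) :
    ∃ A A' : Matrix (Fin 2) (Fin 2) ℂ, A * A' = 1 ∧ A *ᵥ ![1, 0] = x := by
  refine ⟨!![x 0, -conj (x 1); x 1, conj (x 0)], !![conj (x 0), conj (x 1); -x 1, x 0], ?_, ?_⟩
  · simp only [dotProduct, Fin.sum_univ_two, Pi.star_apply, RCLike.star_def] at hx
    ext i j
    fin_cases i <;> fin_cases j <;> simp <;>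
      first | ring1 | linear_combination hx
  · ext i
    fin_cases i <;> simp

theorem blockForm_one {d s : ℕ} (x : Fin d → ℂ) (y : Fin s → ℂ) :
    blockForm 1 x y = (star x ⬝ᵥ x) * (star y ⬝ᵥ y) := by
  simp only [blockForm, one_mulVec, dotProduct, Fintype.sum_prod_type, Finset.sum_mul_sum,
    vecTensor_apply, Pi.star_apply, star_mul']
  refine Finset.sum_congr rfl fun i _ => Finset.sum_congr rfl fun j _ => ?_
  ring

/-- The vector `0` is included, with `r = 0`. -/
theorem exists_normalize (x : Fin 2 → ℂ) : ∃ (r : ℝ) (u : Fin 2 → ℂ),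
    star u ⬝ᵥ u = 1 ∧ x = (r : ℂ) • u := by
  by_cases hx : x = 0
  · exact ⟨0, ![1, 0], by simp [dotProduct], by simp [hx]⟩
  · have h1 : star x ⬝ᵥ x = ((Complex.normSq (x 0) + Complex.normSq (x 1) : ℝ) : ℂ) := by
      simp [dotProduct, Complex.normSq_eq_conj_mul_self]
    set t := Complex.normSq (x 0) + Complex.normSq (x 1) with ht
    have h0 : 0 < t := by
      refine lt_of_le_of_ne (add_nonneg (Complex.normSq_nonneg _) (Complex.normSq_nonneg _)) ?_
      intro h
      rw [← h, Complex.ofReal_zero, dotProduct_star_self_eq_zero] at h1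
      exact hx h1
    have h2 : (Real.sqrt t : ℂ) ≠ 0 := by
      simpa using (Real.sqrt_pos.mpr h0).ne'
    have h3 : (Real.sqrt t : ℂ) * Real.sqrt t = t := by
      rw [← Complex.ofReal_mul, Real.mul_self_sqrt h0.le]
    refine ⟨Real.sqrt t, ((Real.sqrt t : ℂ)⁻¹) • x, ?_, ?_⟩
    · rw [star_smul, smul_dotProduct, dotProduct_smul, h1]
      simp only [smul_eq_mul, star_inv₀, RCLike.star_def, Complex.conj_ofReal]
      field_simp
      rw [sq, h3]
    · rw [smul_smul, mul_inv_cancel₀ h2, one_smul]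

theorem blockForm_smul_smul {d s : ℕ} (M : TensorMat d s) (r t : ℝ) (x : Fin d → ℂ)
    (y : Fin s → ℂ) :
    blockForm M ((r : ℂ) • x) ((t : ℂ) • y) = ((r * t) ^ 2 : ℝ) * blockForm M x y := by
  simp only [blockForm_eq_sum, Finset.mul_sum]
  refine Finset.sum_congr rfl fun i _ => Finset.sum_congr rfl fun j _ =>
    Finset.sum_congr rfl fun k _ => Finset.sum_congr rfl fun l _ => ?_
  simp
  ring

/-- Subtracting the minimal value `m` of the form over products of unit vectors produces a zero,
which a local congruence moves to `e₀ ⊗ e₀`; the multiple `m • 1` is positive semidefinite. -/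
theorem Bpsd_subset_Decomp : Bpsd 2 2 ⊆ Decomp 2 2 := by
  intro M hM
  obtain ⟨x, y, hx, hy, hmin⟩ := exists_min_blockForm M
  have hre : ∀ x y, blockForm M x y = ((blockForm M x y).re : ℂ) := fun x y =>
    (Complex.conj_eq_iff_re.mp (IsSelfAdjoint.of_nonneg (hM x y)).star_eq).symm
  set m := (blockForm M x y).re with hm
  have hm0 : 0 ≤ m := (Complex.nonneg_iff.mp (hM x y)).1
  have hN : ∀ x' y', blockForm (M + (-m) • 1) x' y' =
      blockForm M x' y' - m * ((star x' ⬝ᵥ x') * (star y' ⬝ᵥ y')) := by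
    intro x' y'
    rw [blockForm_add, blockForm_smul, blockForm_one]
    push_cast
    ring
  have hNB : M + (-m) • 1 ∈ Bpsd 2 2 := by
    intro x' y'
    change 0 ≤ blockForm _ _ _
    obtain ⟨r, u, hu, rfl⟩ := exists_normalize x'
    obtain ⟨t, v, hv, rfl⟩ := exists_normalize y'
    rw [blockForm_smul_smul, hN, hu, hv, hre u v, mul_one, mul_one, ← Complex.ofReal_sub,
      ← Complex.ofReal_mul, Complex.zero_le_real]
    exact mul_nonneg (sq_nonneg _) (sub_nonneg.mpr (hmin u v hu hv))
  obtain ⟨A, A', hA, hAx⟩ := exists_matrix_with_first_column hx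
  obtain ⟨B, B', hB, hBy⟩ := exists_matrix_with_first_column hy
  have h1 : M + (-m) • 1 ∈ Decomp 2 2 := by
    refine mem_Decomp_of_localCongr hA hB
      (mem_Decomp_of_corner_eq_zero (localCongr_mem_Bpsd hNB A B) ?_)
    have h2 : blockForm (localCongr A B (M + (-m) • 1)) ![1, 0] ![1, 0] = 0 := by
      rw [blockForm_localCongr, hAx, hBy, hN, hx, hy, hre x y, ← hm]
      simp
    rw [blockForm_eq_sum] at h2
    simpa [Fin.sum_univ_two] using h2
  have h2 : M = (M + (-m) • 1) + m • 1 := by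
    rw [add_assoc, ← add_smul]
    simp
  rw [h2]
  exact add_mem_Decomp h1 (mem_Decomp_of_posSemidef (PosSemidef.one.smul hm0))

theorem Decomp_eq_Bpsd : Decomp 2 2 = Bpsd 2 2 :=
  (Decomp_subset_Bpsd 2 2).antisymm Bpsd_subset_Decomp

/-! ### The cone and its X-shaped slice -/

theorem isConvexCone_herPart_Bpsd (d s : ℕ) : IsConvexCone (herPart (Bpsd d s)) := by
  have hadd : ∀ A ∈ herPart (Bpsd d s), ∀ B ∈ herPart (Bpsd d s), A + B ∈ herPart (Bpsd d s) := by
    intro A hA B hB x y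
    change 0 ≤ blockForm ((A : TensorMat d s) + (B : TensorMat d s)) x y
    rw [blockForm_add]
    exact add_nonneg (hA x y) (hB x y)
  have hsmul : ∀ c : ℝ, 0 ≤ c → ∀ A ∈ herPart (Bpsd d s), c • A ∈ herPart (Bpsd d s) := by
    intro c hc A hA x y
    change 0 ≤ blockForm (c • (A : TensorMat d s)) x y
    rw [blockForm_smul]
    exact mul_nonneg (Complex.zero_le_real.mpr hc) (hA x y)
  refine ⟨⟨0, fun x y => ?_⟩, ?_, hsmul⟩
  · simp
  · intro A hA B hB a b ha hb _
    exact hadd _ (hsmul a ha A hA) _ (hsmul b hb B hB)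

/-- The X-shaped matrix with real entries, as a vector of `HerTensor 2 2`. -/
def xHer (c a b d p q : ℝ) : HerTensor 2 2 :=
  ⟨xMat c a b d p q, xMat_isHermitian c a b d p q⟩

theorem xHer_add (c a b d p q c' a' b' d' p' q' : ℝ) :
    xHer c a b d p q + xHer c' a' b' d' p' q' =
      xHer (c + c') (a + a') (b + b') (d + d') (p + p') (q + q') := by
  apply Subtype.ext
  simp only [xHer, AddSubgroup.coe_add, xMat_add, Complex.ofReal_add]

theorem smul_xHer (r c a b d p q : ℝ) :
    r • xHer c a b d p q = xHer (r * c) (r * a) (r * b) (r * d) (r * p) (r * q) := by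
  apply Subtype.ext
  simp only [xHer, selfAdjoint.val_smul, xMat, twoBlock, smul_add, smul_single]
  simp

theorem xHer_mem_of_posSemidef {c a b d p q : ℝ} (hc : 0 ≤ c) (ha : 0 ≤ a) (hb : 0 ≤ b)
    (hd : 0 ≤ d) (hp : p ^ 2 ≤ c * d) (hq : q ^ 2 ≤ a * b) :
    xHer c a b d p q ∈ herPart (Decomp 2 2) :=
  mem_Decomp_of_posSemidef (xMat_posSemidef hc ha hb hd (by simpa using hp) (by simpa using hq))

theorem xHer_mem_of_sq_le {a b d p q : ℝ} (ha : 0 ≤ a) (hb : 0 ≤ b) (hd : 0 ≤ d)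
    (h : (|p| + |q|) ^ 2 ≤ a * b) : xHer 0 a b d p q ∈ herPart (Decomp 2 2) :=
  xMat_mem_Decomp ha hb hd (by simpa using h)

theorem zero_mem_herPart_Decomp : (0 : HerTensor 2 2) ∈ herPart (Decomp 2 2) :=
  mem_Decomp_of_posSemidef PosSemidef.zero

theorem add_mem_herPart_Decomp {A B : HerTensor 2 2} (hA : A ∈ herPart (Decomp 2 2))
    (hB : B ∈ herPart (Decomp 2 2)) : A + B ∈ herPart (Decomp 2 2) :=
  add_mem_Decomp hA hB

/-! ### A face that is not exposed -/

/-- The value of the form of a matrix at `e₀ ⊗ e₀`. -/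
def cornerValue : HerTensor 2 2 →ₗ[ℝ] ℝ where
  toFun A := ((A : TensorMat 2 2) (0, 0) (0, 0)).re
  map_add' A B := by simp
  map_smul' r A := by simp

/-- The coefficient of `r²` in the value of the form of a matrix at `(1, r) ⊗ (1, r)`, for real
`r`. -/
def diagonalHessian : HerTensor 2 2 →ₗ[ℝ] ℝ where
  toFun A :=
    ((A : TensorMat 2 2) (0, 1) (0, 1)).re + ((A : TensorMat 2 2) (1, 0) (1, 0)).re +
    ((A : TensorMat 2 2) (0, 0) (1, 1)).re + ((A : TensorMat 2 2) (1, 1) (0, 0)).re +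
    ((A : TensorMat 2 2) (0, 1) (1, 0)).re + ((A : TensorMat 2 2) (1, 0) (0, 1)).re
  map_add' A B := by
    simp
    ring
  map_smul' r A := by
    simp
    ring

theorem cornerValue_apply (A : HerTensor 2 2) :
    cornerValue A = ((A : TensorMat 2 2) (0, 0) (0, 0)).re := rfl

theorem diagonalHessian_apply (A : HerTensor 2 2) : diagonalHessian A =
    ((A : TensorMat 2 2) (0, 1) (0, 1)).re + ((A : TensorMat 2 2) (1, 0) (1, 0)).re +
    ((A : TensorMat 2 2) (0, 0) (1, 1)).re + ((A : TensorMat 2 2) (1, 1) (0, 0)).re +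
    ((A : TensorMat 2 2) (0, 1) (1, 0)).re + ((A : TensorMat 2 2) (1, 0) (0, 1)).re := rfl

theorem cornerValue_xHer (c a b d p q : ℝ) : cornerValue (xHer c a b d p q) = c := by
  simp [cornerValue_apply, xHer, xMat_apply]

theorem diagonalHessian_xHer (c a b d p q : ℝ) :
    diagonalHessian (xHer c a b d p q) = a + b + 2 * p + 2 * q := by
  simp [diagonalHessian_apply, xHer, xMat_apply]
  ring

theorem cornerValue_nonneg {A : HerTensor 2 2} (hA : A ∈ herPart (Bpsd 2 2)) :
    0 ≤ cornerValue A := by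
  have h := (Complex.nonneg_iff.mp (hA ![1, 0] ![1, 0])).1
  change 0 ≤ (blockForm _ _ _).re at h
  rw [blockForm_eq_sum] at h
  simpa [Fin.sum_univ_two, cornerValue_apply] using h

theorem diagonalHessian_nonneg {A : HerTensor 2 2} (hA : A ∈ herPart (Bpsd 2 2))
    (h0 : cornerValue A = 0) : 0 ≤ diagonalHessian A := by
  have key : ∀ r : ℝ, r ≠ 0 →
      0 ≤ diagonalHessian A + r ^ 2 * ((A : TensorMat 2 2) (1, 1) (1, 1)).re := by
    intro r hr
    -- The average over `r` and `-r` removes the terms of odd degree.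
    have h1 := (Complex.nonneg_iff.mp (hA ![1, (r : ℂ)] ![1, (r : ℂ)])).1
    have h2 := (Complex.nonneg_iff.mp (hA ![1, ((-r : ℝ) : ℂ)] ![1, ((-r : ℝ) : ℂ)])).1
    change 0 ≤ (blockForm _ _ _).re at h1 h2
    rw [blockForm_eq_sum] at h1 h2
    simp [Fin.sum_univ_two] at h1 h2
    have h0' : ((A : TensorMat 2 2) (0, 0) (0, 0)).re = 0 := h0
    refine (mul_nonneg_iff_of_pos_left (sq_pos_of_ne_zero hr)).mp ?_
    rw [diagonalHessian_apply]
    nlinarith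
  refine ge_of_tendsto (x := nhdsWithin (0 : ℝ) {0}ᶜ) (f := fun r : ℝ =>
    diagonalHessian A + r ^ 2 * ((A : TensorMat 2 2) (1, 1) (1, 1)).re) ?_
    (eventually_mem_nhdsWithin.mono fun r hr => key r hr)
  have : ContinuousAt (fun r : ℝ =>
      diagonalHessian A + r ^ 2 * ((A : TensorMat 2 2) (1, 1) (1, 1)).re) 0 := by fun_prop
  simpa using this.tendsto.mono_left nhdsWithin_le_nhds

/-- The decomposable matrices whose form vanishes at `e₀ ⊗ e₀` and whose Hessian there degenerates
in the direction `(1, 1)`. -/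
def degenerateFace : Set (HerTensor 2 2) :=
  {A | A ∈ herPart (Decomp 2 2) ∧ cornerValue A = 0 ∧ diagonalHessian A = 0}

theorem isConvexFace_degenerateFace :
    IsConvexFace (herPart (Decomp 2 2)) degenerateFace := by
  have hcone := isConvexCone_herPart_Bpsd 2 2
  rw [← Decomp_eq_Bpsd] at hcone
  refine ⟨⟨0, zero_mem_herPart_Decomp, map_zero _, map_zero _⟩, ?_,
    fun A hA => hA.1, ?_⟩
  · rintro A ⟨hA, hA0, hA1⟩ B ⟨hB, hB0, hB1⟩ a b ha hb hab
    exact ⟨hcone.2.1 hA hB ha hb hab, by simp [hA0, hB0], by simp [hA1, hB1]⟩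
  · rintro A hA B hB _ ⟨-, h0, h1⟩ ⟨a, b, ha, hb, -, rfl⟩
    simp only [map_add, map_smul, smul_eq_mul] at h0 h1
    have hA' := hA
    have hB' := hB
    rw [Decomp_eq_Bpsd] at hA' hB'
    have hA0 := mul_nonneg ha.le (cornerValue_nonneg hA')
    have hB0 := mul_nonneg hb.le (cornerValue_nonneg hB')
    have hA0' : cornerValue A = 0 :=
      (mul_eq_zero.mp (by linarith : a * cornerValue A = 0)).resolve_left ha.ne'
    have hB0' : cornerValue B = 0 :=
      (mul_eq_zero.mp (by linarith : b * cornerValue B = 0)).resolve_left hb.ne'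
    have hA1 := mul_nonneg ha.le (diagonalHessian_nonneg hA' hA0')
    have hB1 := mul_nonneg hb.le (diagonalHessian_nonneg hB' hB0')
    exact ⟨hA, hA0',
      (mul_eq_zero.mp (by linarith : a * diagonalHessian A = 0)).resolve_left ha.ne'⟩

/-- An exposing functional `l` would be nonnegative on the squares `|ts - ε|²`, whose constant term
in `ε` lies in the face. The term linear in `ε` then shows that `l` also vanishes on a form whose
Hessian at `e₀ ⊗ e₀` is nondegenerate. -/
theorem not_isExposedFace_degenerateFace :
    ¬ IsExposedFace (herPart (Decomp 2 2)) degenerateFace := by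
  rintro ⟨-, heq | ⟨l, hl, heq⟩⟩
  · have h1 : xHer 1 0 0 0 0 0 ∈ herPart (Decomp 2 2) :=
      xHer_mem_of_posSemidef (by simp) (by simp) (by simp) (by simp) (by simp) (by simp)
    rw [← heq] at h1
    simpa [cornerValue_xHer] using h1.2.1
  · have hmem : ∀ A ∈ degenerateFace, l A = 0 := by
      intro A hA
      rw [heq] at hA
      exact hA.2
    have hl0 : l 0 = 0 := hmem 0 ⟨zero_mem_herPart_Decomp, map_zero _, map_zero _⟩
    have hlin : ∀ A, l A = l.linear A := by
      intro A
      have := l.map_vadd 0 A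
      simpa [hl0] using this
    have h1 : l.linear (xHer 0 1 1 0 0 (-1)) = 0 := by
      rw [← hlin]
      refine hmem _ ⟨xHer_mem_of_sq_le (by simp) (by simp) (by simp) (by simp), ?_, ?_⟩
      · rw [cornerValue_xHer]
      · rw [diagonalHessian_xHer]
        norm_num
    have h2 : l.linear (xHer 0 1 1 0 (-1) 0) = 0 := by
      rw [← hlin]
      refine hmem _ ⟨xHer_mem_of_sq_le (by simp) (by simp) (by simp) (by simp), ?_, ?_⟩
      · rw [cornerValue_xHer]
      · rw [diagonalHessian_xHer]
        norm_num
    have h3 : l.linear (xHer 0 0 0 1 0 0) = 0 := by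
      rw [← hlin]
      refine hmem _ ⟨xHer_mem_of_sq_le (by simp) (by simp) (by simp) (by simp), ?_, ?_⟩
      · rw [cornerValue_xHer]
      · rw [diagonalHessian_xHer]
        norm_num
    set u := l.linear (xHer 1 0 0 0 0 0) with hu
    set v := l.linear (xHer 0 0 0 0 1 0) with hv
    have h4 : ∀ ε : ℝ, 0 ≤ ε ^ 2 * u - ε * v := by
      intro ε
      have h5 : xHer (ε ^ 2) 0 0 1 (-ε) 0 =
          ε ^ 2 • xHer 1 0 0 0 0 0 + xHer 0 0 0 1 0 0 + (-ε) • xHer 0 0 0 0 1 0 := by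
        simp only [smul_xHer, xHer_add]
        congr 1 <;> ring
      have h6 := hl (xHer (ε ^ 2) 0 0 1 (-ε) 0) (xHer_mem_of_posSemidef (sq_nonneg _) le_rfl le_rfl
        zero_le_one (by simp) (by simp))
      rw [hlin, h5, map_add, map_add, map_smul, map_smul, h3, ← hu, ← hv] at h6
      simp only [smul_eq_mul] at h6
      linarith
    have hv0 : v = 0 := by
      by_contra hne
      -- At `ε = v / (|u| + 1)` the linear term dominates.
      have h5 := h4 (v / (|u| + 1))
      have h6 : 0 < |u| + 1 := by positivity
      have h7 : (v / (|u| + 1)) ^ 2 * u - v / (|u| + 1) * v =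
          v ^ 2 * (u - |u| - 1) / (|u| + 1) ^ 2 := by
        field_simp
        ring
      rw [h7] at h5
      have h8 : v ^ 2 * (u - |u| - 1) < 0 :=
        mul_neg_of_pos_of_neg (by positivity) (by linarith [le_abs_self u])
      exact absurd h5 (not_le.mpr (div_neg_of_neg_of_pos h8 (by positivity)))
    have h5 : xHer 0 2 2 0 (-1 / 2) (-1) =
        xHer 0 1 1 0 0 (-1) + xHer 0 1 1 0 (-1) 0 + (1 / 2 : ℝ) • xHer 0 0 0 0 1 0 := by
      simp only [smul_xHer, xHer_add]
      norm_num
    have h6 : xHer 0 2 2 0 (-1 / 2) (-1) ∈ degenerateFace := by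
      rw [heq]
      refine ⟨xHer_mem_of_sq_le (by simp) (by simp) (by simp) ?_, ?_⟩
      · norm_num [abs_of_pos]
      · rw [hlin, h5, map_add, map_add, map_smul, h1, h2, ← hv, hv0]
        simp
    have h7 := h6.2.2
    rw [diagonalHessian_xHer] at h7
    norm_num at h7

open Filter Topology

/-! ### Failure of basic closedness -/

theorem exists_mem_Ioo_eval_ne_zero {q : Polynomial ℝ} (hq : q ≠ 0) {a b : ℝ} (h : a < b) :
    ∃ x ∈ Set.Ioo a b, q.eval x ≠ 0 := by
  obtain ⟨x, hx, hx'⟩ := (Set.Ioo_infinite h).exists_notMem_finset q.roots.toFinset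
  exact ⟨x, hx, fun h0 => hx' (by simpa [hq] using h0)⟩

theorem continuous_evalEval (Q : Polynomial (Polynomial ℝ)) (α : ℝ) :
    Continuous fun η => Q.evalEval α η := by
  have : (fun η => Q.evalEval α η) = fun η => (Q.map (Polynomial.evalRingHom α)).eval η := by
    ext η
    rw [Polynomial.map_evalRingHom_eval]
  rw [this]
  exact Polynomial.continuous _

/-- Let a polynomial `P` be nonnegative at `(α, η)` for small `η` of either sign when `0 < α < 1`,
and for `η ≥ 0` when `-1 < α < 0`. Its lowest order term in `η` then has even degree, by the first
condition, so that for generic `α < 0` the polynomial is nonnegative for small `η < 0` as well. -/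
theorem exists_generic_nonneg (P : Polynomial (Polynomial ℝ))
    (h₁ : ∀ α ∈ Set.Ioo (0 : ℝ) 1, ∀ η, |η| ≤ α ^ 2 → 0 ≤ P.evalEval α η)
    (h₂ : ∀ α ∈ Set.Ioo (-1 : ℝ) 0, ∀ η, 0 ≤ η → 0 ≤ P.evalEval α η) :
    ∃ q : Polynomial ℝ, q ≠ 0 ∧ ∀ α ∈ Set.Ioo (-1 : ℝ) 0, q.eval α ≠ 0 →
      ∀ᶠ η in 𝓝 0, 0 ≤ P.evalEval α η := by
  by_cases hP : P = 0
  · exact ⟨1, one_ne_zero, by simp [hP]⟩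
  obtain ⟨Q, hPQ, hQ⟩ := Polynomial.exists_eq_pow_rootMultiplicity_mul_and_not_dvd P hP 0
  set k := P.rootMultiplicity 0
  rw [map_zero, sub_zero] at hPQ hQ
  rw [Polynomial.X_dvd_iff] at hQ
  have hev : ∀ α η, P.evalEval α η = η ^ k * Q.evalEval α η := by
    intro α η
    rw [hPQ]
    simp
  have hlim : ∀ α, Tendsto (fun η => Q.evalEval α η) (𝓝 0) (𝓝 ((Q.coeff 0).eval α)) := by
    intro α
    convert (continuous_evalEval Q α).tendsto 0 using 2
    rw [Polynomial.evalEval, map_zero, Polynomial.coeff_zero_eq_eval_zero]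
  have hpos : ∀ α, (∀ᶠ η in 𝓝[>] 0, 0 ≤ P.evalEval α η) → 0 ≤ (Q.coeff 0).eval α := by
    intro α h
    refine ge_of_tendsto ((hlim α).mono_left nhdsWithin_le_nhds) (x := 𝓝[>] 0) ?_
    filter_upwards [h, self_mem_nhdsWithin] with η hη hη0
    rw [hev] at hη
    exact (mul_nonneg_iff_of_pos_left (pow_pos hη0 k)).mp hη
  have hk : Even k := by
    obtain ⟨α, hα, hα0⟩ := exists_mem_Ioo_eval_ne_zero hQ zero_lt_one
    have hsmall : ∀ᶠ η in 𝓝 (0 : ℝ), 0 ≤ P.evalEval α η := by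
      have h0 : (0 : ℝ) < α ^ 2 := pow_pos hα.1 2
      filter_upwards [Metric.ball_mem_nhds (0 : ℝ) h0] with η hη
      rw [mem_ball_zero_iff, Real.norm_eq_abs] at hη
      exact h₁ α hα η hη.le
    by_contra hodd
    rw [Nat.not_even_iff_odd] at hodd
    refine hα0 (le_antisymm ?_ (hpos α (hsmall.filter_mono nhdsWithin_le_nhds)))
    refine le_of_tendsto ((hlim α).mono_left nhdsWithin_le_nhds) (x := 𝓝[<] 0) ?_
    filter_upwards [hsmall.filter_mono nhdsWithin_le_nhds, self_mem_nhdsWithin] with η hη hη0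
    rw [hev] at hη
    by_contra! hc
    exact absurd hη (not_le.mpr (mul_neg_of_neg_of_pos (hodd.pow_neg hη0) hc))
  refine ⟨Q.coeff 0, hQ, fun α hα hα0 => ?_⟩
  have h0 : 0 < (Q.coeff 0).eval α := lt_of_le_of_ne
    (hpos α (eventually_nhdsWithin_of_forall fun η hη => h₂ α hα η (le_of_lt hη))) hα0.symm
  filter_upwards [(hlim α).eventually (lt_mem_nhds h0)] with η hη
  rw [hev]
  exact mul_nonneg (hk.pow_nonneg η) hη.le

/-- Let `A + α • B + (α² + η) • C` lie in `S` for small `η` of either sign when `0 < α < 1`, and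
for `η ≥ 0` but not for `η < 0` when `-1 < α < 0`. Then `S` is not basic closed: the Zariski
closure of the boundary arc `η = 0`, `α < 0` passes through `S` at `α > 0`, without bounding it. -/
theorem not_isBasicClosedSemialgebraic_of_arc {V : Type*} [AddCommGroup V] [Module ℝ V]
    {S : Set V} (A B C : V)
    (h₁ : ∀ α ∈ Set.Ioo (0 : ℝ) 1, ∀ η, |η| ≤ α ^ 2 → A + α • B + (α ^ 2 + η) • C ∈ S)
    (h₂ : ∀ α ∈ Set.Ioo (-1 : ℝ) 0, ∀ η, 0 ≤ η → A + α • B + (α ^ 2 + η) • C ∈ S)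
    (h₃ : ∀ α ∈ Set.Ioo (-1 : ℝ) 0, ∀ η, η < 0 → A + α • B + (α ^ 2 + η) • C ∉ S) :
    ¬ IsBasicClosedSemialgebraic S := by
  rintro ⟨n, e, r, p, hS⟩
  have hmem : ∀ v, v ∈ S ↔ ∀ i, 0 ≤ MvPolynomial.eval (e v) (p i) := by
    intro v
    have : e v ∈ e '' S ↔ v ∈ S := e.injective.mem_set_image
    rw [← this, hS]
    rfl
  let w : Fin n → Polynomial (Polynomial ℝ) := fun j =>
    Polynomial.C (Polynomial.C (e A j)) + Polynomial.C (Polynomial.X * Polynomial.C (e B j)) +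
      (Polynomial.C (Polynomial.X ^ 2) + Polynomial.X) * Polynomial.C (Polynomial.C (e C j))
  have hev : ∀ i α η, (MvPolynomial.aeval w (p i)).evalEval α η =
      MvPolynomial.eval (e (A + α • B + (α ^ 2 + η) • C)) (p i) := by
    intro i α η
    rw [MvPolynomial.aeval_def, ← Polynomial.coe_evalEvalRingHom, MvPolynomial.hom_eval₂,
      MvPolynomial.eval, MvPolynomial.coe_eval₂Hom]
    congr 1
    · ext x
      simp
    · ext j
      simp [w]
      ring
  choose q hq0 hq using fun i => exists_generic_nonneg (MvPolynomial.aeval w (p i))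
    (fun α hα η hη => by
      rw [hev]
      exact (hmem _).mp (h₁ α hα η hη) i)
    (fun α hα η hη => by
      rw [hev]
      exact (hmem _).mp (h₂ α hα η hη) i)
  obtain ⟨α, hα, hα0⟩ := exists_mem_Ioo_eval_ne_zero
    (Finset.prod_ne_zero_iff.mpr fun i _ => hq0 i : ∏ i, q i ≠ 0) (neg_one_lt_zero (R := ℝ))
  rw [Polynomial.eval_prod, Finset.prod_ne_zero_iff] at hα0
  have hall : ∀ᶠ η in 𝓝[<] (0 : ℝ), ∀ i, 0 ≤ (MvPolynomial.aeval w (p i)).evalEval α η :=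
    (eventually_all.mpr fun i => hq i α hα (hα0 i (Finset.mem_univ i))).filter_mono
      nhdsWithin_le_nhds
  obtain ⟨η, hη, hη0⟩ := (hall.and self_mem_nhdsWithin).exists
  refine h₃ α hα η hη0 ((hmem _).mpr fun i => ?_)
  rw [← hev]
  exact hη i

/-- The slice consists of the forms `c + (1 + α)(|s|² + |t|²) - 2 Re(st) + |st|²`, whose minimum
over `|s| = |t| = √ρ` is `c + 2αρ + ρ²`. -/
theorem not_isBasicClosedSemialgebraic_herPart_Decomp :
    ¬ IsBasicClosedSemialgebraic (herPart (Decomp 2 2)) := by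
  have hslice : ∀ α c : ℝ, xHer 0 1 1 1 (-1) 0 + α • xHer 0 1 1 0 0 0 + c • xHer 1 0 0 0 0 0 =
      xHer c (1 + α) (1 + α) 1 (-1) 0 := by
    intro α c
    simp [smul_xHer, xHer_add]
  refine not_isBasicClosedSemialgebraic_of_arc (xHer 0 1 1 1 (-1) 0) (xHer 0 1 1 0 0 0)
    (xHer 1 0 0 0 0 0) ?_ ?_ ?_
  · rintro α ⟨hα, -⟩ η hη
    have hc : 0 ≤ α ^ 2 + η := by linarith [neg_le_of_abs_le hη]
    rw [hslice, show xHer (α ^ 2 + η) (1 + α) (1 + α) 1 (-1) 0 =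
      xHer 0 (1 + α) (1 + α) 1 (-1) 0 + xHer (α ^ 2 + η) 0 0 0 0 0 by simp [xHer_add]]
    refine add_mem_herPart_Decomp (xHer_mem_of_sq_le (by linarith) (by linarith) zero_le_one ?_)
      (xHer_mem_of_posSemidef hc le_rfl le_rfl le_rfl (by simp) (by simp))
    simp only [abs_neg, abs_one, abs_zero, add_zero]
    nlinarith
  · rintro α ⟨hα, -⟩ η hη
    have ha : 0 ≤ 1 + α := by linarith
    -- The form is `(1 + α)|s - t̄|² + |st + α|² + η`.
    rw [hslice, show xHer (α ^ 2 + η) (1 + α) (1 + α) 1 (-1) 0 =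
      xHer 0 (1 + α) (1 + α) 0 (-(1 + α)) 0 + xHer (α ^ 2 + η) 0 0 1 α 0 by simp [xHer_add]]
    refine add_mem_herPart_Decomp (xHer_mem_of_sq_le ha ha le_rfl ?_)
      (xHer_mem_of_posSemidef (by positivity) le_rfl le_rfl zero_le_one (by linarith) (by simp))
    rw [abs_neg, abs_of_nonneg ha, abs_zero, add_zero, sq]
  · rintro α ⟨-, hα⟩ η hη hmem
    rw [hslice] at hmem
    -- The form takes its minimum `η` at `s = t = √(-α)`.
    have h1 := Decomp_subset_Bpsd 2 2 hmem ![1, (Real.sqrt (-α) : ℂ)] ![1, (Real.sqrt (-α) : ℂ)]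
    change 0 ≤ blockForm (xMat _ _ _ _ _ _) _ _ at h1
    rw [blockForm_xMat, Complex.zero_le_real] at h1
    have h2 : Real.sqrt (-α) * Real.sqrt (-α) = -α := Real.mul_self_sqrt (by linarith)
    simp [Complex.normSq_apply, h2] at h1
    nlinarith

/-! ### Spectrahedra are basic closed -/

/-- The real part of a complex polynomial, as a function of real variables, is a polynomial. -/
theorem exists_eval_eq_re {σ : Type*} (q : MvPolynomial σ ℂ) :
    ∃ p : MvPolynomial σ ℝ, ∀ a : σ → ℝ,
      MvPolynomial.eval a p = (MvPolynomial.eval (fun j => (a j : ℂ)) q).re := by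
  suffices ∃ p p' : MvPolynomial σ ℝ, ∀ a : σ → ℝ,
      MvPolynomial.eval a p = (MvPolynomial.eval (fun j => (a j : ℂ)) q).re ∧
      MvPolynomial.eval a p' = (MvPolynomial.eval (fun j => (a j : ℂ)) q).im from
    let ⟨p, _, h⟩ := this
    ⟨p, fun a => (h a).1⟩
  induction q using MvPolynomial.induction_on with
  | C z => exact ⟨MvPolynomial.C z.re, MvPolynomial.C z.im, fun a => by simp⟩
  | add q₁ q₂ h₁ h₂ =>
    obtain ⟨p₁, p₁', h₁⟩ := h₁
    obtain ⟨p₂, p₂', h₂⟩ := h₂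
    exact ⟨p₁ + p₂, p₁' + p₂', fun a => by simp [(h₁ a).1, (h₁ a).2, (h₂ a).1, (h₂ a).2]⟩
  | mul_X q j h =>
    obtain ⟨p, p', h⟩ := h
    exact ⟨p * MvPolynomial.X j, p' * MvPolynomial.X j, fun a => by simp [(h a).1, (h a).2]⟩

theorem coeff_prod_X_add_C_nonneg {ι : Type*} (s : Finset ι) {f : ι → ℝ} (hf : ∀ i ∈ s, 0 ≤ f i)
    (k : ℕ) : 0 ≤ (∏ i ∈ s, (Polynomial.X + Polynomial.C (f i))).coeff k := by
  classical
  induction s using Finset.induction_on generalizing k with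
  | empty =>
    rw [Finset.prod_empty, Polynomial.coeff_one]
    positivity
  | insert i s hi ih =>
    have ih' := ih fun j hj => hf j (Finset.mem_insert_of_mem hj)
    rw [Finset.prod_insert hi, add_mul, Polynomial.coeff_add, Polynomial.coeff_C_mul]
    refine add_nonneg ?_ (mul_nonneg (hf i (Finset.mem_insert_self i s)) (ih' k))
    cases k with
    | zero => simp
    | succ k =>
      rw [Polynomial.coeff_X_mul]
      exact ih' k

/-- The characteristic polynomial of `-A` is `∏ (X + λᵢ)` with `λᵢ` the eigenvalues of `A`. If
its coefficients are nonnegative, it has no positive root, so that no `λᵢ` is negative. -/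
theorem posSemidef_iff_charpoly_neg_coeff_nonneg {n : Type*} [Fintype n] [DecidableEq n]
    {A : Matrix n n ℂ} (hA : A.IsHermitian) :
    A.PosSemidef ↔ ∀ k < Fintype.card n + 1, 0 ≤ ((-A).charpoly.coeff k).re := by
  have hchar : (-A).charpoly = (∏ i, (Polynomial.X + Polynomial.C (hA.eigenvalues i))).map
      Complex.ofRealHom := by
    refine Polynomial.funext fun z => ?_
    rw [eval_charpoly, show scalar n z - -A = -(scalar n (-z) - A) by
        rw [map_neg]
        abel, det_neg,
      ← eval_charpoly, hA.charpoly_eq, Polynomial.eval_prod, ← Finset.card_univ,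
      ← Finset.prod_const, ← Finset.prod_mul_distrib, Polynomial.eval_map, 
      Polynomial.eval₂_finsetProd]
    refine Finset.prod_congr rfl fun i _ => ?_
    simp
    ring
  have hcoeff : ∀ k, ((-A).charpoly.coeff k).re =
      (∏ i, (Polynomial.X + Polynomial.C (hA.eigenvalues i))).coeff k := by
    intro k
    rw [hchar, Polynomial.coeff_map]
    simp
  simp only [hcoeff]
  rw [hA.posSemidef_iff_eigenvalues_nonneg]
  refine ⟨fun h k _ => coeff_prod_X_add_C_nonneg _ (fun i _ => h i) k, fun h i => ?_⟩
  by_contra! hi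
  have hi' : hA.eigenvalues i < 0 := hi
  set R := ∏ i, (Polynomial.X + Polynomial.C (hA.eigenvalues i)) with hR
  have hdeg : R.natDegree = Fintype.card n := by
    rw [hR, Polynomial.natDegree_prod_of_monic _ _ fun i _ => Polynomial.monic_X_add_C _]
    simp
  have hmonic : R.Monic := Polynomial.monic_prod_of_monic _ _ fun i _ => Polynomial.monic_X_add_C _
  have hroot : R.eval (-hA.eigenvalues i) = 0 := by
    rw [hR, Polynomial.eval_prod]
    exact Finset.prod_eq_zero (Finset.mem_univ i) (by simp)
  have hpos : 0 < R.eval (-hA.eigenvalues i) := by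
    rw [Polynomial.eval_eq_sum_range]
    refine Finset.sum_pos' (fun k hk => ?_) ⟨R.natDegree, by simp, ?_⟩
    · rw [hdeg, Finset.mem_range] at hk
      exact mul_nonneg (h k hk) (pow_nonneg (by linarith) k)
    · rw [hmonic.coeff_natDegree, one_mul]
      exact pow_pos (by linarith) _
  exact hpos.ne' hroot

theorem IsSpectrahedronCoord.isBasicClosedSemialgebraicCoord {n : ℕ} {S : Set (Fin n → ℝ)}
    (h : IsSpectrahedronCoord S) : IsBasicClosedSemialgebraicCoord S := by
  obtain ⟨r, B, hB, rfl⟩ := h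
  -- The generic matrix `-∑ xᵢ Bᵢ` over the polynomial ring.
  let G : Matrix (Fin r) (Fin r) (MvPolynomial (Fin n) ℂ) :=
    -∑ i, (MvPolynomial.X i : MvPolynomial (Fin n) ℂ) • (B i).map MvPolynomial.C
  choose p hp using fun k : Fin (r + 1) => exists_eval_eq_re (G.charpoly.coeff k)
  refine ⟨r + 1, p, Set.ext fun a => ?_⟩
  have hH : (∑ i, a i • B i).IsHermitian := by
    rw [IsHermitian, conjTranspose_sum]
    exact Finset.sum_congr rfl fun i _ => by rw [conjTranspose_smul, (hB i).eq, star_trivial]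
  have hG : G.map (MvPolynomial.eval fun j => (a j : ℂ)) = -∑ i, a i • B i := by
    ext k l
    simp [G, Matrix.sum_apply]
  have hcoeff : ∀ k, MvPolynomial.eval (fun j => (a j : ℂ)) (G.charpoly.coeff k) =
      (-∑ i, a i • B i).charpoly.coeff k := by
    intro k
    rw [← hG, charpoly_map, Polynomial.coeff_map]
  simp only [Set.mem_ofPred_eq, hp, hcoeff]
  rw [posSemidef_iff_charpoly_neg_coeff_nonneg hH, Fintype.card_fin]
  exact ⟨fun h k => h k k.2, fun h k hk => h ⟨k, hk⟩⟩

theorem IsSpectrahedron.isBasicClosedSemialgebraic {V : Type*} [AddCommGroup V] [Module ℝ V]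
    {S : Set V} (h : IsSpectrahedron S) : IsBasicClosedSemialgebraic S :=
  let ⟨n, e, he⟩ := h
  ⟨n, e, he.isBasicClosedSemialgebraicCoord⟩

theorem proposition3p3 :
    Decomp 2 2 = Bpsd 2 2 ∧
    (∀ M ∈ Decomp 2 2, M.IsHermitian) ∧
    IsConvexCone (herPart (Decomp 2 2)) ∧
    (∃ F : Set (HerTensor 2 2),
      IsConvexFace (herPart (Decomp 2 2)) F ∧ ¬ IsExposedFace (herPart (Decomp 2 2)) F) ∧
    ¬ IsBasicClosedSemialgebraic (herPart (Decomp 2 2)) ∧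
    ¬ IsSpectrahedron (herPart (Decomp 2 2)) := by
  refine ⟨Decomp_eq_Bpsd, fun M hM => isHermitian_of_mem_Decomp hM, ?_,
    ⟨degenerateFace, isConvexFace_degenerateFace, not_isExposedFace_degenerateFace⟩,
    not_isBasicClosedSemialgebraic_herPart_Decomp,
    fun h => not_isBasicClosedSemialgebraic_herPart_Decomp h.isBasicClosedSemialgebraic⟩
  rw [Decomp_eq_Bpsd]
  exact isConvexCone_herPart_Bpsd 2 2
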